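/- Let $n\ge 0$, let $H_n$ be the Lindenbaum algebra of intuitionistic propositional logic in the variables $x_1,\dots,x_n$ (formulas modulo intuitionistic equivalence, ordered by $\phi\le\psi$ iff $\phi\vdash\psi$), i.e. the free Heyting algebra on $n$ generators. Let $J_n$ be the poset of join-irreducible elements of $H_n$ (the minimum $\bot$ is not counted as join-irreducible). Let $J_{1,n}$ be the set of $\phi\in J_n$ with only finitely many elements of $J_n$ below $\phi$, let $J_{2,n}$ be the set of minimal elements of $J_n\setminus J_{1,n}$, and let $J_{3,n}=J_n\setminus(J_{1,n}\cup J_{2,n})$. We do not distinguish a formula from its class. Let $K_n$ be Bellissima's Kripke model. Each node $\alpha$ is determined by the set $w(\alpha)$ of variables forced at it and by its finite set of immediate successors, and the nodes are generated as follows: for every set $U$ of variables there is a node with no successors and with $w=U$; for every finite antichain $S$ of nodes with $|S|\ge 2$ and every $U\subseteq\bigcap_{\alpha\in S}w(\alpha)$ there is a node with set of immediate successors $S$ and with $w=U$; for every node $\alpha$ and every $U\subsetneq w(\alpha)$ there is a node with $\alpha$ as its only immediate successor and with $w=U$. The order of $K_n$ is the reflexive transitive closure of the relation "$\beta$ is an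 immediate successor of $\alpha$", written $\alpha\le\beta$. For a formula $\phi$ let $k(\phi)=\{\alpha\in K_n\mid \alpha\Vdash\phi\}$. Let $\phi\in J_{3,n}$, and let $S$ be a finite set of join-irreducible formulas such that $\phi\not\le\psi$ for all $\psi\in S$. Then there is a $\rho\in J_{3,n}$ such that $\rho<\phi$ and $k(\rho)\cap k(\psi)$ is finite for every $\psi\in S$. -/

import Mathlib

/-! # Free Heyting algebras, their join-irreducible elements, and the universal Kripke model -/

namespace FreeHeyting

/-! ## Propositional formulas and intuitionistic provability -/

/-- Propositional formulas in the variables `x_i`, `i : Fin n`. Negation is `φ → ⊥` and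
truth is `⊥ → ⊥`. -/
inductive Formula (n : ℕ) : Type
  | var : Fin n → Formula n
  | bot : Formula n
  | and : Formula n → Formula n → Formula n
  | or : Formula n → Formula n → Formula n
  | imp : Formula n → Formula n → Formula n

/-- Intuitionistic natural deduction: `Proves Γ φ` says that `φ` is derivable from `Γ`. -/
inductive Proves {n : ℕ} : Set (Formula n) → Formula n → Prop
  | ax {Γ : Set (Formula n)} {φ : Formula n} : φ ∈ Γ → Proves Γ φ
  | botE {Γ : Set (Formula n)} {φ : Formula n} : Proves Γ Formula.bot → Proves Γ φ
  | andI {Γ : Set (Formula n)} {φ ψ : Formula n} :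
      Proves Γ φ → Proves Γ ψ → Proves Γ (Formula.and φ ψ)
  | andE₁ {Γ : Set (Formula n)} {φ ψ : Formula n} : Proves Γ (Formula.and φ ψ) → Proves Γ φ
  | andE₂ {Γ : Set (Formula n)} {φ ψ : Formula n} : Proves Γ (Formula.and φ ψ) → Proves Γ ψ
  | orI₁ {Γ : Set (Formula n)} {φ ψ : Formula n} : Proves Γ φ → Proves Γ (Formula.or φ ψ)
  | orI₂ {Γ : Set (Formula n)} {φ ψ : Formula n} : Proves Γ ψ → Proves Γ (Formula.or φ ψ)
  | orE {Γ : Set (Formula n)} {φ ψ χ : Formula n} :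
      Proves Γ (Formula.or φ ψ) → Proves (insert φ Γ) χ → Proves (insert ψ Γ) χ → Proves Γ χ
  | impI {Γ : Set (Formula n)} {φ ψ : Formula n} :
      Proves (insert φ Γ) ψ → Proves Γ (Formula.imp φ ψ)
  | impE {Γ : Set (Formula n)} {φ ψ : Formula n} :
      Proves Γ (Formula.imp φ ψ) → Proves Γ φ → Proves Γ ψ

theorem Proves.weaken {n : ℕ} {Γ Δ : Set (Formula n)} {φ : Formula n} (h : Proves Γ φ)
    (hΓ : Γ ⊆ Δ) : Proves Δ φ := by
  induction h generalizing Δ with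
  | ax h => exact .ax (hΓ h)
  | botE _ ih => exact .botE (ih hΓ)
  | andI _ _ ih₁ ih₂ => exact .andI (ih₁ hΓ) (ih₂ hΓ)
  | andE₁ _ ih => exact .andE₁ (ih hΓ)
  | andE₂ _ ih => exact .andE₂ (ih hΓ)
  | orI₁ _ ih => exact .orI₁ (ih hΓ)
  | orI₂ _ ih => exact .orI₂ (ih hΓ)
  | orE _ _ _ ih₁ ih₂ ih₃ =>
    exact .orE (ih₁ hΓ) (ih₂ (Set.insert_subset_insert hΓ)) (ih₃ (Set.insert_subset_insert hΓ))
  | impI _ ih => exact .impI (ih (Set.insert_subset_insert hΓ))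
  | impE _ _ ih₁ ih₂ => exact .impE (ih₁ hΓ) (ih₂ hΓ)

theorem Proves.cut {n : ℕ} {Γ : Set (Formula n)} {φ ψ : Formula n} (h : Proves Γ φ)
    (h' : Proves {φ} ψ) : Proves Γ ψ :=
  .impE (.impI (h'.weaken (by simp))) h

/-- `φ ≤ ψ` means `φ ⊢ ψ`. -/
instance (n : ℕ) : Preorder (Formula n) where
  le φ ψ := Proves {φ} ψ
  le_refl _ := .ax rfl
  le_trans _ _ _ h h' := h.cut h'

theorem le_def {n : ℕ} {φ ψ : Formula n} : φ ≤ ψ ↔ Proves {φ} ψ := Iff.rfl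

/-! ## The Lindenbaum algebra -/

/-- The Lindenbaum algebra `H_n` of intuitionistic propositional logic: formulas modulo
`φ ⊢ ψ` and `ψ ⊢ φ`, ordered by `⊢`. -/
abbrev H (n : ℕ) : Type := Antisymmetrization (Formula n) (· ≤ ·)

/-- The class of a formula in `H_n`. -/
def cls {n : ℕ} (φ : Formula n) : H n := toAntisymmetrization (· ≤ ·) φ

theorem cls_le_cls {n : ℕ} {φ ψ : Formula n} : cls φ ≤ cls ψ ↔ Proves {φ} ψ := Iff.rfl

theorem and_le_left {n : ℕ} (φ ψ : Formula n) : φ.and ψ ≤ φ := .andE₁ (.ax rfl)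

theorem and_le_right {n : ℕ} (φ ψ : Formula n) : φ.and ψ ≤ ψ := .andE₂ (.ax rfl)

theorem le_and {n : ℕ} {φ ψ χ : Formula n} (h₁ : φ ≤ ψ) (h₂ : φ ≤ χ) : φ ≤ ψ.and χ :=
  .andI h₁ h₂

theorem left_le_or {n : ℕ} (φ ψ : Formula n) : φ ≤ φ.or ψ := .orI₁ (.ax rfl)

theorem right_le_or {n : ℕ} (φ ψ : Formula n) : ψ ≤ φ.or ψ := .orI₂ (.ax rfl)

theorem or_le {n : ℕ} {φ ψ χ : Formula n} (h₁ : φ ≤ χ) (h₂ : ψ ≤ χ) : φ.or ψ ≤ χ :=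
  .orE (.ax rfl) (Proves.weaken h₁ (by simp)) (Proves.weaken h₂ (by simp))

theorem le_imp_iff {n : ℕ} {φ ψ χ : Formula n} : φ ≤ ψ.imp χ ↔ φ.and ψ ≤ χ := by
  constructor
  · intro h
    exact .impE ((and_le_left φ ψ).trans h) (and_le_right φ ψ)
  · intro h
    exact .impI (Proves.cut (.andI (.ax (by simp)) (.ax (by simp))) h)

instance (n : ℕ) : HeytingAlgebra (H n) where
  sup := Quotient.map₂ Formula.or fun _ _ h _ _ h' =>
    ⟨or_le (h.1.trans (left_le_or _ _)) (h'.1.trans (right_le_or _ _)),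
      or_le (h.2.trans (left_le_or _ _)) (h'.2.trans (right_le_or _ _))⟩
  le_sup_left a b := Quotient.inductionOn₂ a b left_le_or
  le_sup_right a b := Quotient.inductionOn₂ a b right_le_or
  sup_le a b c := Quotient.inductionOn₃ a b c fun _ _ _ => or_le
  inf := Quotient.map₂ Formula.and fun _ _ h _ _ h' =>
    ⟨le_and ((and_le_left _ _).trans h.1) ((and_le_right _ _).trans h'.1),
      le_and ((and_le_left _ _).trans h.2) ((and_le_right _ _).trans h'.2)⟩
  inf_le_left a b := Quotient.inductionOn₂ a b and_le_left
  inf_le_right a b := Quotient.inductionOn₂ a b and_le_right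
  le_inf a b c := Quotient.inductionOn₃ a b c fun _ _ _ => le_and
  top := cls (Formula.bot.imp Formula.bot)
  le_top a := Quotient.inductionOn a fun _ => .impI (.ax (by simp))
  himp := Quotient.map₂ Formula.imp fun _ _ h _ _ h' =>
    ⟨le_imp_iff.2 ((le_and (and_le_left _ _) ((and_le_right _ _).trans h.2)).trans
        ((le_imp_iff.1 le_rfl).trans h'.1)),
      le_imp_iff.2 ((le_and (and_le_left _ _) ((and_le_right _ _).trans h.1)).trans
        ((le_imp_iff.1 le_rfl).trans h'.2))⟩
  le_himp_iff a b c := Quotient.inductionOn₃ a b c fun _ _ _ => le_imp_iff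
  bot := cls Formula.bot
  bot_le a := Quotient.inductionOn a fun _ => .botE (.ax rfl)
  compl := Quotient.map (fun φ => φ.imp Formula.bot) fun _ _ h =>
    ⟨le_imp_iff.2 ((le_and (and_le_left _ _) ((and_le_right _ _).trans h.2)).trans
        (le_imp_iff.1 le_rfl)),
      le_imp_iff.2 ((le_and (and_le_left _ _) ((and_le_right _ _).trans h.1)).trans
        (le_imp_iff.1 le_rfl))⟩
  himp_bot a := Quotient.inductionOn a fun _ => rfl

theorem cls_or {n : ℕ} (φ ψ : Formula n) : cls (φ.or ψ) = cls φ ⊔ cls ψ := rfl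

theorem cls_and {n : ℕ} (φ ψ : Formula n) : cls (φ.and ψ) = cls φ ⊓ cls ψ := rfl

theorem cls_imp {n : ℕ} (φ ψ : Formula n) : cls (φ.imp ψ) = cls φ ⇨ cls ψ := rfl

theorem cls_bot {n : ℕ} : cls (Formula.bot : Formula n) = ⊥ := rfl

/-! ## The three layers of join-irreducible elements -/

/-- `J_n`: the join-irreducible elements of `H_n` (the minimum `⊥`, the empty join, is not
join-irreducible). -/
def J (n : ℕ) : Set (H n) := {a | SupIrred a}

/-- `J_{1,n}`: the elements of `J_n` with only finitely many elements of `J_n` below them. -/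
def J₁ (n : ℕ) : Set (H n) := {a | a ∈ J n ∧ {b | b ∈ J n ∧ b < a}.Finite}

/-- `J_{2,n}`: the minimal elements of `J_n \ J_{1,n}`. -/
def J₂ (n : ℕ) : Set (H n) := {a | Minimal (fun b => b ∈ J n \ J₁ n) a}

/-- `J_{3,n}`: the remaining elements of `J_n`. -/
def J₃ (n : ℕ) : Set (H n) := J n \ (J₁ n ∪ J₂ n)

/-! ## Kripke semantics -/

/-- Forcing in the Kripke model with underlying order `W`, where `w a` is the set of variables
forced at `a`. -/
def Forces {n : ℕ} {W : Type*} [Preorder W] (w : W → Set (Fin n)) : W → Formula n → Prop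
  | a, .var i => i ∈ w a
  | _, .bot => False
  | a, .and φ ψ => Forces w a φ ∧ Forces w a ψ
  | a, .or φ ψ => Forces w a φ ∨ Forces w a ψ
  | a, .imp φ ψ => ∀ b, a ≤ b → Forces w b φ → Forces w b ψ

/-! ## Bellissima's model

A node of the model is determined by the finite set `U` of variables forced there and the finite
set `S` of its immediate successors. We represent it by a natural number, its code: codes are
in bijection with pairs `(U, S)` of finite sets of natural numbers, where `S` is the set of codes
of the immediate successors. -/

/-- The code of the pair `(U, S)`. -/
def code (U S : Finset ℕ) : ℕ :=
  Nat.pair (Finset.equivBitIndices.symm U) (Finset.equivBitIndices.symm S)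

/-- The first component (the variables) of the pair with code `c`. -/
def vars (c : ℕ) : Finset ℕ := Finset.equivBitIndices (Nat.unpair c).1

/-- The second component (the immediate successors) of the pair with code `c`. -/
def succs (c : ℕ) : Finset ℕ := Finset.equivBitIndices (Nat.unpair c).2

theorem vars_code (U S : Finset ℕ) : vars (code U S) = U := by simp [vars, code]

theorem succs_code (U S : Finset ℕ) : succs (code U S) = S := by simp [succs, code]

theorem code_vars_succs (c : ℕ) : code (vars c) (succs c) = c := by simp [vars, succs, code]

theorem lt_of_mem_succs {c d : ℕ} (h : d ∈ succs c) : d < c := by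
  have h1 : d ∈ (Nat.unpair c).2.bitIndices := by
    simpa [succs, Finset.equivBitIndices] using h
  exact (Nat.lt_two_pow_self.trans_le (Nat.two_pow_le_of_mem_bitIndices h1)).trans_le
    (Nat.unpair_right_le c)

/-- `CodeLE c d`: the node coded by `d` is reached from the one coded by `c` by passing
finitely many times (possibly zero) to an immediate successor. -/
def CodeLE : ℕ → ℕ → Prop := Relation.ReflTransGen fun c d => d ∈ succs c

theorem CodeLE.le {c d : ℕ} (h : CodeLE c d) : d ≤ c := by
  induction h with
  | refl => exact le_rfl
  | tail _ h ih => exact (lt_of_mem_succs h).le.trans ih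

/-- `IsNode n c`: `c` codes a node of Bellissima's model over the variables `x_0, …, x_{n-1}`.
The nodes are generated as follows, `U` ranging over sets of variables:
* for every `U` there is a node `(U, ∅)` without successors;
* for every finite antichain `S` of nodes with at least two elements and every `U` contained in
  `w α` for all `α ∈ S`, there is a node `(U, S)`;
* for every node `α` and every `U` strictly contained in `w α`, there is a node `(U, {α})`. -/
inductive IsNode (n : ℕ) : ℕ → Prop
  | mk (c : ℕ) (vars_lt : ∀ i ∈ vars c, i < n) (succs_node : ∀ d ∈ succs c, IsNode n d)
      (antichain : IsAntichain CodeLE (succs c : Set ℕ))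
      (vars_subset : ∀ d ∈ succs c, vars c ⊆ vars d)
      (vars_ne : ∀ d, succs c = {d} → vars c ≠ vars d) : IsNode n c

/-- The set of nodes of Bellissima's model `K_n`. -/
def K (n : ℕ) : Type := {c : ℕ // IsNode n c}

/-- The order of `K_n`: `α ≤ β` iff `β` is reached from `α` by passing to immediate
successors; so `β` forces at least as much as `α`. -/
instance (n : ℕ) : PartialOrder (K n) where
  le α β := CodeLE α.1 β.1
  le_refl _ := Relation.ReflTransGen.refl
  le_trans _ _ _ h h' := Relation.ReflTransGen.trans h h'
  le_antisymm _ _ h h' := Subtype.ext (le_antisymm h'.le h.le)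

/-- The set of variables forced at a node of `K_n`. -/
def w {n : ℕ} (α : K n) : Set (Fin n) := {i | (i : ℕ) ∈ vars α.1}

/-- `k(φ)`: the set of nodes of `K_n` that force `φ`. -/
def k {n : ℕ} (φ : Formula n) : Set (K n) := {α | Forces w α φ}

end FreeHeyting

/-! By soundness and completeness for `K n`, the map `k` embeds `H n` into the upper sets of `K n`,
and every principal upper set and every complement of a principal lower set is definable
(`definable_Ici_and_compl_Iic`). Hence join-irreducible means nonempty and downward directed
(`cls_mem_J_iff`), and `J₁` consists of the join-irreducibles with finite `k` (`cls_mem_J₁_iff`).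

Let `D = k φ`. Since `φ` is in `J₃`, some infinite `k χ` lies properly inside `D`. Far enough down,
the subformulas of `φ` have settled truth values, so `D` is closed under adding new nodes there
(`exists_closedBelow`). Directedness gives a node `α` of `D` in that region which forces neither `χ`
nor any formula of `S`. As infinitely many nodes of `D` are not below `α`, three incomparable nodes
`b i` can be built below `α` (`ClosedBelow.exists_triple`).

The formula `ρ` defines `tripod D b`. An element of it is either above some `b i`, which leaves
finitely many, or below `α`, where no formula of `S` is forced; so the intersections are finite. The
tripod is directed, and replacing the `b i` by the nodes whose successors are pairs of them gives a
strictly smaller tripod (`IsTriple.exists_ssubset`). Iteration shows that tripods are infinite, so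
`ρ` has an infinite join-irreducible strictly below it and belongs to `J₃`. -/

namespace FreeHeyting

/-! ## Nodes of Bellissima's model -/

/-- The set of immediate successors of a node. -/
def isucc {n : ℕ} (α : K n) : Set (K n) := {β | β.1 ∈ succs α.1}

theorem isucc_finite {n : ℕ} (α : K n) : (isucc α).Finite :=
  (succs α.1).finite_toSet.preimage Subtype.val_injective.injOn

theorem IsNode.of_mem_succs {n c d : ℕ} (h : IsNode n c) (hd : d ∈ succs c) : IsNode n d := by
  cases h with
  | mk _ _ h' => exact h' d hd

theorem K.code_lt {n : ℕ} {α β : K n} (h : α < β) : β.1 < α.1 :=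
  lt_of_le_of_ne (CodeLE.le h.le) fun e => h.ne (Subtype.ext e.symm)

/-- Codes drop along the order, which allows induction from the top of the model downwards. -/
instance (n : ℕ) : WellFoundedGT (K n) :=
  ⟨Subrelation.wf (fun {_ _} h => K.code_lt h)
    (InvImage.wf (fun α : K n => α.1) Nat.lt_wfRel.wf)⟩

theorem K.lt_iff {n : ℕ} {α δ : K n} : α < δ ↔ ∃ s ∈ isucc α, s ≤ δ := by
  constructor
  · intro h
    rcases Relation.ReflTransGen.cases_head h.le with e | ⟨d, hd, h'⟩
    · exact absurd (Subtype.ext e) h.ne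
    · exact ⟨⟨d, α.2.of_mem_succs hd⟩, hd, h'⟩
  · rintro ⟨s, hs, h⟩
    refine lt_of_le_not_ge (Relation.ReflTransGen.head hs h) fun h' => ?_
    exact absurd ((lt_of_mem_succs hs).trans_le (CodeLE.le h')) (CodeLE.le h).not_gt

theorem K.lt_of_mem_isucc {n : ℕ} {α s : K n} (h : s ∈ isucc α) : α < s :=
  K.lt_iff.2 ⟨s, h, le_rfl⟩

theorem isucc_antichain {n : ℕ} (α : K n) : IsAntichain (· ≤ ·) (isucc α) := by
  obtain ⟨c, hc⟩ := α
  cases hc with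
  | mk _ _ _ h =>
    intro a ha b hb hab hle
    exact h ha hb (fun e => hab (Subtype.ext e)) hle

theorem w_subset_of_mem_isucc {n : ℕ} {α s : K n} (h : s ∈ isucc α) : w α ⊆ w s := by
  obtain ⟨c, hc⟩ := α
  cases hc with
  | mk _ _ _ _ h' => exact fun i hi => h' _ h hi

theorem w_mono {n : ℕ} {α β : K n} (h : α ≤ β) : w α ⊆ w β := by
  induction α using WellFoundedGT.induction with
  | _ α ih =>
    rcases h.eq_or_lt with rfl | h
    · exact subset_rfl
    · obtain ⟨s, hs, hsβ⟩ := K.lt_iff.1 h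
      exact (w_subset_of_mem_isucc hs).trans (ih s (K.lt_of_mem_isucc hs) hsβ)

theorem K.lt_of_mem_vars {n : ℕ} (α : K n) {i : ℕ} (hi : i ∈ vars α.1) : i < n := by
  obtain ⟨c, hc⟩ := α
  cases hc with
  | mk _ h => exact h i hi

theorem vars_subset_of_w_subset {n : ℕ} {α β : K n} (h : w α ⊆ w β) : vars α.1 ⊆ vars β.1 :=
  fun i hi => @h ⟨i, α.lt_of_mem_vars hi⟩ hi

theorem succs_subset_of_isucc_subset {n : ℕ} {α β : K n} (h : isucc α ⊆ isucc β) :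
    succs α.1 ⊆ succs β.1 :=
  fun d hd => @h ⟨d, α.2.of_mem_succs hd⟩ hd

theorem K.ext_of_isucc {n : ℕ} {α β : K n} (hw : w α = w β) (hs : isucc α = isucc β) :
    α = β := by
  apply Subtype.ext
  rw [← code_vars_succs α.1, ← code_vars_succs β.1,
    (vars_subset_of_w_subset hw.subset).antisymm (vars_subset_of_w_subset hw.superset),
    (succs_subset_of_isucc_subset hs.subset).antisymm (succs_subset_of_isucc_subset hs.superset)]

theorem w_ne_of_isucc_eq_singleton {n : ℕ} {α s : K n} (h : isucc α = {s}) : w α ≠ w s := by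
  intro hw
  have hv : vars α.1 = vars s.1 :=
    (vars_subset_of_w_subset hw.subset).antisymm (vars_subset_of_w_subset hw.superset)
  have hs : succs α.1 = {s.1} := by
    ext d
    rw [Finset.mem_singleton]
    constructor
    · intro hd
      have : (⟨d, α.2.of_mem_succs hd⟩ : K n) ∈ isucc α := hd
      rw [h] at this
      exact congrArg Subtype.val this
    · rintro rfl
      exact h.superset rfl
  obtain ⟨c, hc⟩ := α
  cases hc with
  | mk _ _ _ _ _ h' => exact h' _ hs hv

/-- All three generation rules at once: `hne` has content only when `S` is a singleton, where with
`hU` it makes the inclusion of variables strict. -/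
theorem exists_node {n : ℕ} {S : Set (K n)} (hS : S.Finite) (ha : IsAntichain (· ≤ ·) S)
    {U : Set (Fin n)} (hU : ∀ s ∈ S, U ⊆ w s) (hne : ∀ s, S = {s} → U ≠ w s) :
    ∃ γ : K n, w γ = U ∧ isucc γ = S := by
  classical
  set V : Finset ℕ := U.toFinite.toFinset.map Fin.valEmbedding
  set T : Finset ℕ := hS.toFinset.map (⟨fun s => s.1, Subtype.val_injective⟩ : K n ↪ ℕ)
  have hV : ∀ i, i ∈ V ↔ ∃ h : i < n, (⟨i, h⟩ : Fin n) ∈ U := by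
    intro i
    simp only [V, Finset.mem_map, Set.Finite.mem_toFinset, Fin.valEmbedding_apply]
    constructor
    · rintro ⟨a, ha, rfl⟩
      exact ⟨a.2, ha⟩
    · rintro ⟨h, hi⟩
      exact ⟨_, hi, rfl⟩
  have hT : ∀ d, d ∈ T ↔ ∃ s ∈ S, s.1 = d := by
    intro d
    simp only [T, Finset.mem_map, Set.Finite.mem_toFinset]
    exact Iff.rfl
  have hVw : ∀ s ∈ S, V ⊆ vars s.1 := by
    intro s hs i hi
    obtain ⟨h, hi⟩ := (hV i).1 hi
    exact hU s hs hi
  refine ⟨⟨code V T, ⟨_, ?_, ?_, ?_, ?_, ?_⟩⟩, ?_, ?_⟩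
  · intro i hi
    rw [vars_code] at hi
    exact ((hV i).1 hi).1
  · intro d hd
    rw [succs_code] at hd
    obtain ⟨s, -, rfl⟩ := (hT d).1 hd
    exact s.2
  · rw [succs_code]
    intro a haT b hbT hab hle
    obtain ⟨s, hs, rfl⟩ := (hT a).1 haT
    obtain ⟨t, ht, rfl⟩ := (hT b).1 hbT
    exact ha hs ht (fun e => hab (congrArg Subtype.val e)) hle
  · intro d hd
    rw [succs_code] at hd
    obtain ⟨s, hs, rfl⟩ := (hT d).1 hd
    rw [vars_code]
    exact hVw s hs
  · intro d hd hv
    rw [succs_code] at hd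
    rw [vars_code] at hv
    obtain ⟨s, hs, rfl⟩ := (hT d).1 (hd ▸ Finset.mem_singleton_self d)
    refine hne s (Set.eq_singleton_iff_unique_mem.2 ⟨hs, fun t ht => ?_⟩) ?_
    · have : t.1 ∈ T := (hT _).2 ⟨t, ht, rfl⟩
      rw [hd, Finset.mem_singleton] at this
      exact Subtype.ext this
    · ext i
      change i ∈ U ↔ (i : ℕ) ∈ vars s.1
      rw [← hv, hV]
      exact ⟨fun h => ⟨i.2, h⟩, fun h => h.2⟩
  · ext i
    change (i : ℕ) ∈ vars (code V T) ↔ _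
    rw [vars_code, hV]
    exact ⟨fun h => h.2, fun h => ⟨i.2, h⟩⟩
  · ext s
    change s.1 ∈ succs (code V T) ↔ _
    rw [succs_code, hT]
    exact ⟨fun ⟨t, ht, e⟩ => Subtype.ext e ▸ ht, fun h => ⟨s, h, rfl⟩⟩

theorem finite_Ici {n : ℕ} (α : K n) : (Set.Ici α).Finite :=
  ((Set.finite_Iic α.1).preimage Subtype.val_injective.injOn).subset fun _ h => CodeLE.le h

/-! ## Soundness and definable sets -/

theorem Forces.mono {n : ℕ} {φ : Formula n} {α β : K n} (hαβ : α ≤ β) (h : Forces w α φ) :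
    Forces w β φ := by
  induction φ with
  | var i => exact w_mono hαβ h
  | bot => exact h
  | and _ _ ih₁ ih₂ => exact ⟨ih₁ h.1, ih₂ h.2⟩
  | or _ _ ih₁ ih₂ => exact h.imp ih₁ ih₂
  | imp _ _ _ _ => exact fun γ hγ => h γ (hαβ.trans hγ)

theorem isUpperSet_k {n : ℕ} (φ : Formula n) : IsUpperSet (k φ) := fun _ _ h hα => hα.mono h

theorem Proves.sound {n : ℕ} {Γ : Set (Formula n)} {φ : Formula n} (h : Proves Γ φ) {α : K n}
    (hα : ∀ χ ∈ Γ, Forces w α χ) : Forces w α φ := by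
  induction h generalizing α with
  | ax h => exact hα _ h
  | botE _ ih => exact (ih hα).elim
  | andI _ _ ih₁ ih₂ => exact ⟨ih₁ hα, ih₂ hα⟩
  | andE₁ _ ih => exact (ih hα).1
  | andE₂ _ ih => exact (ih hα).2
  | orI₁ _ ih => exact Or.inl (ih hα)
  | orI₂ _ ih => exact Or.inr (ih hα)
  | orE _ _ _ ih₁ ih₂ ih₃ =>
    rcases ih₁ hα with h | h
    · exact ih₂ (Set.forall_mem_insert.2 ⟨h, hα⟩)
    · exact ih₃ (Set.forall_mem_insert.2 ⟨h, hα⟩)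
  | impI _ ih =>
    exact fun β hβ h => ih (Set.forall_mem_insert.2 ⟨h, fun χ hχ => (hα χ hχ).mono hβ⟩)
  | impE _ _ ih₁ ih₂ => exact ih₁ hα _ le_rfl (ih₂ hα)

/-- A set of nodes is definable if it is `k(φ)` for some formula `φ`. -/
def Definable {n : ℕ} (A : Set (K n)) : Prop := ∃ φ : Formula n, k φ = A

theorem Definable.inter {n : ℕ} {A B : Set (K n)} (hA : Definable A) (hB : Definable B) :
    Definable (A ∩ B) := by
  obtain ⟨φ, rfl⟩ := hA
  obtain ⟨ψ, rfl⟩ := hB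
  exact ⟨φ.and ψ, rfl⟩

theorem Definable.union {n : ℕ} {A B : Set (K n)} (hA : Definable A) (hB : Definable B) :
    Definable (A ∪ B) := by
  obtain ⟨φ, rfl⟩ := hA
  obtain ⟨ψ, rfl⟩ := hB
  exact ⟨φ.or ψ, rfl⟩

theorem Definable.himp {n : ℕ} {A B : Set (K n)} (hA : Definable A) (hB : Definable B) :
    Definable {α | ∀ β, α ≤ β → β ∈ A → β ∈ B} := by
  obtain ⟨φ, rfl⟩ := hA
  obtain ⟨ψ, rfl⟩ := hB
  exact ⟨φ.imp ψ, rfl⟩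

theorem definable_empty {n : ℕ} : Definable (∅ : Set (K n)) := ⟨.bot, rfl⟩

theorem definable_univ {n : ℕ} : Definable (Set.univ : Set (K n)) :=
  ⟨Formula.bot.imp .bot, Set.eq_univ_of_forall fun _ _ _ h => h⟩

theorem definable_var {n : ℕ} (i : Fin n) : Definable {α : K n | i ∈ w α} := ⟨.var i, rfl⟩

theorem Definable.biUnion {n : ℕ} {ι : Type*} {s : Set ι} (hs : s.Finite) {f : ι → Set (K n)}
    (h : ∀ i ∈ s, Definable (f i)) : Definable (⋃ i ∈ s, f i) := by
  induction s, hs using Set.Finite.induction_on with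
  | empty => simpa using definable_empty
  | insert _ _ ih =>
    rw [Set.biUnion_insert]
    exact (h _ (Set.mem_insert _ _)).union (ih fun i hi => h i (Set.mem_insert_of_mem _ hi))

theorem Definable.biInter {n : ℕ} {ι : Type*} {s : Set ι} (hs : s.Finite) {f : ι → Set (K n)}
    (h : ∀ i ∈ s, Definable (f i)) : Definable (⋂ i ∈ s, f i) := by
  induction s, hs using Set.Finite.induction_on with
  | empty => simpa using definable_univ
  | insert _ _ ih =>
    rw [Set.biInter_insert]
    exact (h _ (Set.mem_insert _ _)).inter (ih fun i hi => h i (Set.mem_insert_of_mem _ hi))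

/-! ### Definability of principal upper sets and of complements of principal lower sets -/

/-- The description of the principal upper set of `α` through its immediate successors. -/
theorem Ici_eq {n : ℕ} (α : K n) : Set.Ici α = (⋂ i ∈ w α, {γ : K n | i ∈ w γ}) ∩
    {γ | ∀ δ, γ ≤ δ → δ ∈ (⋃ i ∈ {i | i ∉ w α ∧ ∀ s ∈ isucc α, i ∈ w s}, {δ : K n | i ∈ w δ}) ∪
      (⋃ s ∈ isucc α, (Set.Iic s)ᶜ) → δ ∈ ⋃ s ∈ isucc α, Set.Ici s} := by
  ext γ
  simp only [Set.mem_inter_iff, Set.mem_iInter, Set.mem_ofPred_eq, Set.mem_union, Set.mem_iUnion,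
    Set.mem_Ici, Set.mem_compl_iff, Set.mem_Iic, exists_prop]
  constructor
  · intro h
    refine ⟨fun i hi => w_mono h hi, fun δ hδ hδ' => ?_⟩
    rcases (h.trans hδ).eq_or_lt with rfl | hlt
    · rcases hδ' with ⟨i, hi, hi'⟩ | ⟨s, hs, hs'⟩
      · exact absurd hi' hi.1
      · exact absurd (K.lt_of_mem_isucc hs).le hs'
    · exact K.lt_iff.1 hlt
  · rintro ⟨hw, h⟩
    induction γ using WellFoundedGT.induction with
    | _ γ ih =>
      -- If `γ` is above no successor of `α`, the condition at `γ` itself says that `γ` forces no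
      -- new variable and lies below every successor of `α`. Comparing the two antichains of
      -- successors then gives `γ = α`.
      by_cases hγ : ∃ s ∈ isucc α, s ≤ γ
      · exact (K.lt_iff.2 hγ).le
      have hsucc : ∀ t ∈ isucc γ, α ≤ t := fun t ht =>
        ih t (K.lt_of_mem_isucc ht) (fun i hi => w_mono (K.lt_of_mem_isucc ht).le (hw i hi))
          fun δ hδ => h δ ((K.lt_of_mem_isucc ht).le.trans hδ)
      have hnew : ∀ i ∈ w γ, (∀ s ∈ isucc α, i ∈ w s) → i ∈ w α := by
        intro i hi his
        by_contra hα
        exact hγ (h γ le_rfl (Or.inl ⟨i, ⟨hα, his⟩, hi⟩))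
      have hle : ∀ s ∈ isucc α, γ ≤ s := by
        intro s hs
        by_contra hn
        exact hγ (h γ le_rfl (Or.inr ⟨s, hs, hn⟩))
      by_cases hα : α ∈ isucc γ
      · exfalso
        have hs : isucc γ = {α} := Set.eq_singleton_iff_unique_mem.2 ⟨hα, fun t ht =>
          ((isucc_antichain γ).eq hα ht (hsucc t ht)).symm⟩
        exact w_ne_of_isucc_eq_singleton hs
          ((w_mono (K.lt_of_mem_isucc hα).le).antisymm hw)
      have h₁ : ∀ t ∈ isucc γ, ∃ s ∈ isucc α, s ≤ t := fun t ht =>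
        K.lt_iff.1 (lt_of_le_of_ne (hsucc t ht) fun e => hα (e ▸ ht))
      have h₂ : ∀ s ∈ isucc α, ∃ t ∈ isucc γ, t ≤ s := fun s hs =>
        K.lt_iff.1 (lt_of_le_of_ne (hle s hs) fun e => hγ ⟨s, hs, e.ge⟩)
      have hS : isucc α = isucc γ := by
        apply Set.Subset.antisymm
        · intro s hs
          obtain ⟨t, ht, hts⟩ := h₂ s hs
          obtain ⟨s', hs', hst⟩ := h₁ t ht
          have e := (isucc_antichain α).eq hs' hs (hst.trans hts)
          have : t = s := hts.antisymm (e ▸ hst)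
          exact this ▸ ht
        · intro t ht
          obtain ⟨s, hs, hst⟩ := h₁ t ht
          obtain ⟨t', ht', hts⟩ := h₂ s hs
          have e := (isucc_antichain γ).eq ht' ht (hts.trans hst)
          have : s = t := hst.antisymm (e ▸ hts)
          exact this ▸ hs
      refine (K.ext_of_isucc (Set.Subset.antisymm hw fun i hi => hnew i hi fun s hs => ?_) hS).le
      exact w_mono (hle s hs) hi

/-- The implication from the upper set of `α` to its strict part can fail only at `α` itself. -/
theorem compl_Iic_eq {n : ℕ} (α : K n) : (Set.Iic α)ᶜ =
    {γ | ∀ δ, γ ≤ δ → δ ∈ Set.Ici α → δ ∈ ⋃ s ∈ isucc α, Set.Ici s} := by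
  ext γ
  simp only [Set.mem_compl_iff, Set.mem_Iic, Set.mem_Ici, Set.mem_ofPred_eq, Set.mem_iUnion,
    exists_prop]
  constructor
  · intro h δ hγ hα
    exact K.lt_iff.1 (lt_of_le_of_ne hα fun e => h (e ▸ hγ))
  · intro h hγ
    exact (K.lt_iff.2 (h α hγ le_rfl)).false

/-- The two claims need a joint induction: `Ici_eq` uses both for the successors, and `compl_Iic_eq`
uses the upper set of `α`. -/
theorem definable_Ici_and_compl_Iic {n : ℕ} (α : K n) :
    Definable (Set.Ici α) ∧ Definable (Set.Iic α)ᶜ := by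
  induction α using WellFoundedGT.induction with
  | _ α ih =>
    have hU : Definable (⋃ s ∈ isucc α, Set.Ici s) :=
      .biUnion (isucc_finite α) fun s hs => (ih s (K.lt_of_mem_isucc hs)).1
    have hI : Definable (Set.Ici α) := by
      rw [Ici_eq]
      exact (Definable.biInter (Set.toFinite _) fun i _ => definable_var i).inter
        (((Definable.biUnion (Set.toFinite _) fun i _ => definable_var i).union
          (.biUnion (isucc_finite α) fun s hs => (ih s (K.lt_of_mem_isucc hs)).2)).himp hU)
    refine ⟨hI, ?_⟩
    rw [compl_Iic_eq]
    exact hI.himp hU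

theorem definable_Ici {n : ℕ} (α : K n) : Definable (Set.Ici α) :=
  (definable_Ici_and_compl_Iic α).1

theorem definable_compl_Iic {n : ℕ} (α : K n) : Definable (Set.Iic α)ᶜ :=
  (definable_Ici_and_compl_Iic α).2

/-! ## Completeness -/

/-- The set of subformulas of a formula. -/
def subformulas {n : ℕ} : Formula n → Set (Formula n)
  | .var i => {.var i}
  | .bot => {.bot}
  | .and φ ψ => insert (.and φ ψ) (subformulas φ ∪ subformulas ψ)
  | .or φ ψ => insert (.or φ ψ) (subformulas φ ∪ subformulas ψ)
  | .imp φ ψ => insert (.imp φ ψ) (subformulas φ ∪ subformulas ψ)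

theorem finite_subformulas {n : ℕ} (φ : Formula n) : (subformulas φ).Finite := by
  induction φ with
  | var i => exact Set.finite_singleton _
  | bot => exact Set.finite_singleton _
  | and _ _ ih₁ ih₂ => exact (ih₁.union ih₂).insert _
  | or _ _ ih₁ ih₂ => exact (ih₁.union ih₂).insert _
  | imp _ _ ih₁ ih₂ => exact (ih₁.union ih₂).insert _

theorem mem_subformulas_self {n : ℕ} (φ : Formula n) : φ ∈ subformulas φ := by
  cases φ with
  | var i => exact rfl
  | bot => exact rfl
  | and _ _ => exact Set.mem_insert _ _
  | or _ _ => exact Set.mem_insert _ _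
  | imp _ _ => exact Set.mem_insert _ _

/-- Prime ideals play the worlds of the canonical model, as the sets of formulas that fail. The
filter generated by `a` and the complement of `I` misses the ideal of `b`, since otherwise `a ⇨ b`
would lie outside `I`. -/
theorem exists_prime_of_himp_mem {H : Type*} [HeytingAlgebra H] {I : Order.Ideal H}
    (hI : I.IsPrime) {a b : H} (h : a ⇨ b ∈ I) :
    ∃ J : Order.Ideal H, J.IsPrime ∧ J ≤ I ∧ a ∉ J ∧ b ∈ J := by
  have hF : Order.IsPFilter {x : H | ∃ t, t ∉ I ∧ t ⊓ a ≤ x} := by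
    refine Order.IsPFilter.of_def ⟨⊤, ⊤, hI.1.top_notMem, le_top⟩ ?_ ?_
    · rintro x ⟨t, ht, htx⟩ y ⟨u, hu, huy⟩
      refine ⟨x ⊓ y, ⟨t ⊓ u, fun h => (hI.mem_or_mem h).elim ht hu, ?_⟩, inf_le_left, inf_le_right⟩
      exact le_inf ((inf_le_inf_right a inf_le_left).trans htx)
        ((inf_le_inf_right a inf_le_right).trans huy)
    · rintro x y hxy ⟨t, ht, htx⟩
      exact ⟨t, ht, htx.trans hxy⟩
  have hdis : Disjoint (hF.toPFilter : Set H) (Order.Ideal.principal b : Set H) := by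
    rw [Set.disjoint_left]
    rintro x ⟨t, ht, htx⟩ hx
    exact ht (I.lower (le_himp_iff.2 (htx.trans hx)) h)
  obtain ⟨J, hJ, hbJ, hFJ⟩ := DistribLattice.prime_ideal_of_disjoint_filter_ideal hdis
  rw [Set.disjoint_left] at hFJ
  refine ⟨J, hJ, fun x hx => ?_, ?_, hbJ (Order.Ideal.mem_principal.2 le_rfl)⟩
  · by_contra hxI
    exact hFJ (show x ∈ {x : H | ∃ t, t ∉ I ∧ t ⊓ a ≤ x} from ⟨x, hxI, inf_le_left⟩) hx
  · exact hFJ (show a ∈ {x : H | ∃ t, t ∉ I ∧ t ⊓ a ≤ x} from ⟨⊤, hI.1.top_notMem, inf_le_right⟩)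

theorem exists_prime_of_not_le {H : Type*} [HeytingAlgebra H] {a b : H} (h : ¬ a ≤ b) :
    ∃ J : Order.Ideal H, J.IsPrime ∧ a ∉ J ∧ b ∈ J := by
  have hdis : Disjoint (Order.PFilter.principal a : Set H) (Order.Ideal.principal b : Set H) := by
    rw [Set.disjoint_left]
    intro x hx hx'
    exact h (le_trans (Order.PFilter.mem_principal.1 hx) (Order.Ideal.mem_principal.1 hx'))
  obtain ⟨J, hJ, hbJ, hFJ⟩ := DistribLattice.prime_ideal_of_disjoint_filter_ideal hdis
  rw [Set.disjoint_left] at hFJ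
  exact ⟨J, hJ, hFJ (Order.PFilter.mem_principal.2 le_rfl),
    hbJ (Order.Ideal.mem_principal.2 le_rfl)⟩

/-- In a finite set of nodes every element is above some minimal one. -/
theorem exists_minimal_node_le {n : ℕ} {A : Set (K n)} (hA : A.Finite) {α : K n} (hα : α ∈ A) :
    ∃ β, Minimal (· ∈ A) β ∧ β ≤ α := by
  obtain ⟨β, h, hβ⟩ := hA.exists_le_minimal hα
  exact ⟨β, hβ, h⟩

/-- A node whose proper upper set is controlled by the finite set `A`, and which is itself
either new or the least element of `A`. -/
theorem exists_node_below {n : ℕ} {A : Set (K n)} (hA : A.Finite) {U : Set (Fin n)}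
    (hU : ∀ α ∈ A, U ⊆ w α) :
    ∃ γ : K n, w γ = U ∧ (∀ α ∈ A, γ ≤ α) ∧
      ∀ δ, γ ≤ δ → δ = γ ∨ ∃ α ∈ A, α ≤ δ := by
  by_cases h : ∃ s, {β | Minimal (· ∈ A) β} = {s} ∧ U = w s
  · obtain ⟨s, hs, rfl⟩ := h
    have hsA : s ∈ A := (show Minimal (· ∈ A) s from hs.superset rfl).prop
    refine ⟨s, rfl, fun α hα => ?_, fun δ hδ => Or.inr ⟨s, hsA, hδ⟩⟩
    obtain ⟨β, hβ, hβα⟩ := exists_minimal_node_le hA hα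
    have : β = s := hs.subset hβ
    exact this ▸ hβα
  · obtain ⟨γ, hγU, hγ⟩ := exists_node (S := {β | Minimal (· ∈ A) β})
      (hA.subset fun β hβ => hβ.prop)
      (fun a ha b hb hab hle => hab (hle.antisymm (hb.2 ha.1 hle))) (fun s hs => hU s hs.prop)
      fun s hs hUs => h ⟨s, hs, hUs⟩
    refine ⟨γ, hγU, fun α hα => ?_, fun δ hδ => ?_⟩
    · obtain ⟨β, hβ, hβα⟩ := exists_minimal_node_le hA hα
      exact (K.lt_iff.2 ⟨β, hγ.superset hβ, hβα⟩).le
    · rcases hδ.eq_or_lt with rfl | hlt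
      · exact Or.inl rfl
      · obtain ⟨s, hs, hsδ⟩ := K.lt_iff.1 hlt
        exact Or.inr ⟨s, (hγ.subset hs).prop, hsδ⟩

/-- The truth lemma for one new node `γ`. By `hwit`, a prime ideal refuting an implication either
agrees with `I` on `T`, so `γ` is the witness, or is represented by a node of `A`. -/
theorem forces_iff_of_prime {n : ℕ} {T : Set (Formula n)} {I : Order.Ideal (H n)}
    (hI : I.IsPrime) {A : Set (K n)} {γ : K n} (hw : w γ = {i | cls (.var i) ∉ I})
    (hle : ∀ α ∈ A, γ ≤ α) (hge : ∀ δ, γ ≤ δ → δ = γ ∨ ∃ α ∈ A, α ≤ δ)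
    (hpers : ∀ α ∈ A, ∀ χ ∈ T, cls χ ∉ I → Forces w α χ)
    (hwit : ∀ J : Order.Ideal (H n), J.IsPrime → J ≤ I → (∀ χ ∈ T, cls χ ∈ I → cls χ ∈ J) ∨
      ∃ α ∈ A, ∀ χ ∈ T, Forces w α χ ↔ cls χ ∉ J)
    (χ : Formula n) (hχ : subformulas χ ⊆ T) : Forces w γ χ ↔ cls χ ∉ I := by
  induction χ with
  | var i => change i ∈ w γ ↔ _; rw [hw]; exact Iff.rfl
  | bot => exact ⟨False.elim, fun h => h I.bot_mem⟩
  | and φ ψ ih₁ ih₂ =>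
    have h₁ := ih₁ fun _ h => hχ (Or.inr (Or.inl h))
    have h₂ := ih₂ fun _ h => hχ (Or.inr (Or.inr h))
    rw [cls_and]
    refine (and_congr h₁ h₂).trans ⟨fun h h' => (hI.mem_or_mem h').elim h.1 h.2, fun h =>
      ⟨fun h' => h (I.lower inf_le_left h'), fun h' => h (I.lower inf_le_right h')⟩⟩
  | or φ ψ ih₁ ih₂ =>
    have h₁ := ih₁ fun _ h => hχ (Or.inr (Or.inl h))
    have h₂ := ih₂ fun _ h => hχ (Or.inr (Or.inr h))
    rw [cls_or, Order.Ideal.sup_mem_iff, not_and_or]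
    exact or_congr h₁ h₂
  | imp φ ψ ih₁ ih₂ =>
    have h₁ := ih₁ fun _ h => hχ (Or.inr (Or.inl h))
    have h₂ := ih₂ fun _ h => hχ (Or.inr (Or.inr h))
    have hφT : φ ∈ T := hχ (Or.inr (Or.inl (mem_subformulas_self φ)))
    have hψT : ψ ∈ T := hχ (Or.inr (Or.inr (mem_subformulas_self ψ)))
    rw [cls_imp]
    constructor
    · intro h hmem
      obtain ⟨J, hJ, hJI, hφJ, hψJ⟩ := exists_prime_of_himp_mem hI hmem
      rcases hwit J hJ hJI with hs | ⟨α, hα, hαJ⟩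
      · exact h₂.1 (h γ le_rfl (h₁.2 fun h' => hφJ (hs φ hφT h'))) (hJI hψJ)
      · exact (hαJ ψ hψT).1 (h α (hle α hα) ((hαJ φ hφT).2 hφJ)) hψJ
    · intro h δ hδ hφδ
      rcases hge δ hδ with rfl | ⟨α, hα, hαδ⟩
      · refine h₂.2 fun hψI => h₁.1 hφδ ?_
        by_contra hφI
        exact (hI.mem_or_mem (I.lower himp_inf_le hψI : (cls φ ⇨ cls ψ) ⊓ cls φ ∈ I)).elim h hφI
      · exact hpers α hα (φ.imp ψ) (hχ (Set.mem_insert _ _)) h δ hαδ hφδ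

/-- Only the finitely many traces on `T` matter. Induction on the size of the trace of `I`
represents every smaller trace by a node, and the node for `I` is placed below these. -/
theorem exists_forces_iff {n : ℕ} {T : Set (Formula n)} (hT : T.Finite)
    (hsub : ∀ χ ∈ T, subformulas χ ⊆ T) (I : Order.Ideal (H n)) (hI : I.IsPrime) :
    ∃ γ : K n, w γ = {i | cls (.var i) ∉ I} ∧ ∀ χ ∈ T, Forces w γ χ ↔ cls χ ∉ I := by
  induction hm : {χ | χ ∈ T ∧ cls χ ∈ I}.ncard using Nat.strong_induction_on generalizing I with
  | _ m ih =>
    subst hm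
    -- the traces on `T` of the prime ideals properly below `I`
    set X : Set (Set (Formula n)) := {Y | ∃ J : Order.Ideal (H n), J.IsPrime ∧ J ≤ I ∧
      (∃ χ ∈ T, cls χ ∈ I ∧ cls χ ∉ J) ∧ {χ | χ ∈ T ∧ cls χ ∈ J} = Y}
    have hX : X.Finite := hT.finite_subsets.subset fun Y ⟨J, _, _, _, hY⟩ => hY ▸ fun χ h => h.1
    have hex : ∀ Y ∈ X, ∃ α : K n, {i | cls (.var i) ∉ I} ⊆ w α ∧
        ∀ χ ∈ T, Forces w α χ ↔ χ ∉ Y := by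
      rintro Y ⟨J, hJ, hJI, ⟨χ, hχT, hχI, hχJ⟩, rfl⟩
      obtain ⟨α, hwα, hα⟩ := ih _ (Set.ncard_lt_ncard
        ⟨fun θ h => ⟨h.1, hJI h.2⟩, fun h => hχJ (h ⟨hχT, hχI⟩).2⟩
        (hT.subset fun _ h => h.1)) J hJ rfl
      refine ⟨α, hwα.superset.trans' fun i hi h => hi (hJI h), fun θ hθ => (hα θ hθ).trans ?_⟩
      exact ⟨fun h h' => h h'.2, fun h h' => h ⟨hθ, h'⟩⟩
    have : Nonempty (K n) :=
      ⟨(exists_node_below Set.finite_empty (U := ∅) fun _ h => h.elim).choose⟩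
    choose! a haw ha using hex
    have hUa : ∀ α ∈ a '' X, {i | cls (.var i) ∉ I} ⊆ w α := by
      rintro _ ⟨Y, hY, rfl⟩
      exact haw Y hY
    obtain ⟨γ, hγw, hle, hge⟩ := exists_node_below (hX.image a) hUa
    refine ⟨γ, hγw, fun χ hχ => forces_iff_of_prime hI hγw hle hge ?_ ?_ χ (hsub χ hχ)⟩
    · rintro _ ⟨Y, hY, rfl⟩ θ hθ hθI
      refine (ha Y hY θ hθ).2 ?_
      obtain ⟨J, -, hJI, -, rfl⟩ := hY
      exact fun h => hθI (hJI h.2)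
    · intro J hJ hJI
      by_cases h : ∃ χ ∈ T, cls χ ∈ I ∧ cls χ ∉ J
      · have hY : {χ | χ ∈ T ∧ cls χ ∈ J} ∈ X := ⟨J, hJ, hJI, h, rfl⟩
        refine Or.inr ⟨_, Set.mem_image_of_mem a hY, fun θ hθ => (ha _ hY θ hθ).trans ?_⟩
        exact ⟨fun h h' => h ⟨hθ, h'⟩, fun h h' => h h'.2⟩
      · left
        intro θ hθ hθI
        by_contra hθJ
        exact h ⟨θ, hθ, hθI, hθJ⟩

theorem subformulas_subset {n : ℕ} {φ χ : Formula n} (h : χ ∈ subformulas φ) :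
    subformulas χ ⊆ subformulas φ := by
  induction φ with
  | var i => rw [Set.mem_singleton_iff.1 h]
  | bot => rw [Set.mem_singleton_iff.1 h]
  | and _ _ ih₁ ih₂ =>
    rcases h with rfl | h | h
    · exact subset_rfl
    · exact fun _ h' => Or.inr (Or.inl (ih₁ h h'))
    · exact fun _ h' => Or.inr (Or.inr (ih₂ h h'))
  | or _ _ ih₁ ih₂ =>
    rcases h with rfl | h | h
    · exact subset_rfl
    · exact fun _ h' => Or.inr (Or.inl (ih₁ h h'))
    · exact fun _ h' => Or.inr (Or.inr (ih₂ h h'))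
  | imp _ _ ih₁ ih₂ =>
    rcases h with rfl | h | h
    · exact subset_rfl
    · exact fun _ h' => Or.inr (Or.inl (ih₁ h h'))
    · exact fun _ h' => Or.inr (Or.inr (ih₂ h h'))

theorem cls_le_cls_iff {n : ℕ} {φ ψ : Formula n} : cls φ ≤ cls ψ ↔ k φ ⊆ k ψ := by
  constructor
  · intro h α hα
    exact (cls_le_cls.1 h).sound (by rintro _ rfl; exact hα)
  · intro h
    by_contra hn
    obtain ⟨I, hI, hφ, hψ⟩ := exists_prime_of_not_le hn
    obtain ⟨γ, -, hγ⟩ := exists_forces_iff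
      ((finite_subformulas φ).union (finite_subformulas ψ))
      (fun χ hχ => hχ.elim (fun h => (subformulas_subset h).trans Set.subset_union_left)
        fun h => (subformulas_subset h).trans Set.subset_union_right) I hI
    exact (hγ ψ (Or.inr (mem_subformulas_self ψ))).1
      (h ((hγ φ (Or.inl (mem_subformulas_self φ))).2 hφ)) hψ

theorem cls_lt_cls_iff {n : ℕ} {φ ψ : Formula n} : cls φ < cls ψ ↔ k φ ⊂ k ψ := by
  rw [lt_iff_le_not_ge, cls_le_cls_iff, cls_le_cls_iff]
  exact Iff.rfl

theorem exists_cls_eq {n : ℕ} (a : H n) : ∃ φ : Formula n, cls φ = a :=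
  Quotient.exists_rep a

/-! ## Join-irreducible elements -/

/-- In a distributive lattice join-irreducible equals join-prime. If `α` and `β` had no common lower
bound in `k φ`, the definable complements of their lower sets would cover `k φ`, yet neither alone
does. -/
theorem cls_mem_J_iff {n : ℕ} {φ : Formula n} :
    cls φ ∈ J n ↔ (k φ).Nonempty ∧ ∀ α ∈ k φ, ∀ β ∈ k φ, ∃ γ ∈ k φ, γ ≤ α ∧ γ ≤ β := by
  change SupIrred (cls φ) ↔ _
  rw [← supPrime_iff_supIrred]
  constructor
  · intro h
    constructor
    · by_contra hn
      refine h.ne_bot (le_bot_iff.1 ?_)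
      rw [← cls_bot, cls_le_cls_iff, Set.not_nonempty_iff_eq_empty.1 hn]
      exact Set.empty_subset _
    · intro α hα β hβ
      by_contra hn
      obtain ⟨ψ₁, h₁⟩ := definable_compl_Iic α
      obtain ⟨ψ₂, h₂⟩ := definable_compl_Iic β
      have hle : cls φ ≤ cls ψ₁ ⊔ cls ψ₂ := by
        rw [← cls_or, cls_le_cls_iff]
        intro γ hγ
        change γ ∈ k ψ₁ ∪ k ψ₂
        rw [h₁, h₂]
        by_contra hγ'
        rw [Set.mem_union, not_or, Set.notMem_compl_iff, Set.notMem_compl_iff] at hγ'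
        exact hn ⟨γ, hγ, hγ'⟩
      rcases h.2 hle with h | h
      · exact (h₁ ▸ cls_le_cls_iff.1 h) hα (Set.mem_Iic.2 le_rfl)
      · exact (h₂ ▸ cls_le_cls_iff.1 h) hβ (Set.mem_Iic.2 le_rfl)
  · rintro ⟨⟨α, hα⟩, hdir⟩
    constructor
    · intro hmin
      exact cls_le_cls_iff.1 (hmin bot_le : cls φ ≤ cls .bot) hα
    · intro b c h
      obtain ⟨ψ₁, rfl⟩ := exists_cls_eq b
      obtain ⟨ψ₂, rfl⟩ := exists_cls_eq c
      rw [← cls_or, cls_le_cls_iff] at h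
      by_contra hn
      rw [not_or, cls_le_cls_iff, cls_le_cls_iff, Set.not_subset, Set.not_subset] at hn
      obtain ⟨⟨α, hα, hα'⟩, β, hβ, hβ'⟩ := hn
      obtain ⟨γ, hγ, hγα, hγβ⟩ := hdir α hα β hβ
      rcases h hγ with h | h
      · exact hα' (h.mono hγα)
      · exact hβ' (h.mono hγβ)

/-- Distinct nodes of `k φ` give distinct join-irreducibles below `φ` through their principal upper
sets; conversely a finite set has finitely many subsets. -/
theorem cls_mem_J₁_iff {n : ℕ} {φ : Formula n} (hφ : cls φ ∈ J n) :
    cls φ ∈ J₁ n ↔ (k φ).Finite := by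
  constructor
  · rintro ⟨-, hfin⟩
    choose θ hθ using fun α : K n => definable_Ici α
    have hJ : ∀ α, cls (θ α) ∈ J n := by
      intro α
      rw [cls_mem_J_iff, hθ]
      exact ⟨⟨α, Set.mem_Ici.2 le_rfl⟩, fun β hβ γ hγ => ⟨α, Set.mem_Ici.2 le_rfl, hβ, hγ⟩⟩
    have hinj : Function.Injective fun α => cls (θ α) := by
      intro α β h
      have h₁ := cls_le_cls_iff.1 (show cls (θ α) ≤ cls (θ β) from h.le)
      have h₂ := cls_le_cls_iff.1 (show cls (θ β) ≤ cls (θ α) from h.ge)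
      rw [hθ, hθ] at h₁ h₂
      exact le_antisymm (h₂ (Set.mem_Ici.2 le_rfl)) (h₁ (Set.mem_Ici.2 le_rfl))
    refine ((hfin.insert (cls φ)).preimage hinj.injOn).subset fun α hα => ?_
    have hle : cls (θ α) ≤ cls φ := by
      rw [cls_le_cls_iff, hθ]
      exact fun β hβ => hα.mono hβ
    rcases hle.eq_or_lt with h | h
    · exact Or.inl h
    · exact Or.inr ⟨hJ α, h⟩
  · intro hfin
    refine ⟨hφ, ?_⟩
    choose f hf using fun a : H n => exists_cls_eq a
    refine Set.Finite.of_finite_image (f := fun a => k (f a))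
      (hfin.finite_subsets.subset ?_) fun a _ b _ hab => ?_
    · rintro _ ⟨a, ⟨-, ha⟩, rfl⟩
      rw [← hf a] at ha
      exact cls_le_cls_iff.1 ha.le
    · have hab : k (f a) = k (f b) := hab
      rw [← hf a, ← hf b]
      exact le_antisymm (cls_le_cls_iff.2 hab.subset) (cls_le_cls_iff.2 hab.superset)

theorem cls_mem_J₃ {n : ℕ} {φ ψ : Formula n} (hφ : cls φ ∈ J n) (hψ : cls ψ ∈ J n)
    (hinf : (k ψ).Infinite) (h : k ψ ⊂ k φ) : cls φ ∈ J₃ n := by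
  refine ⟨hφ, ?_⟩
  rintro (h₁ | h₂)
  · exact hinf (((cls_mem_J₁_iff hφ).1 h₁).subset h.subset)
  · have hlt := cls_lt_cls_iff.2 h
    exact (h₂.2 ⟨hψ, fun h' => hinf ((cls_mem_J₁_iff hψ).1 h')⟩ hlt.le).not_gt hlt

theorem exists_infinite_ssubset_of_mem_J₃ {n : ℕ} {φ : Formula n} (hφ : cls φ ∈ J₃ n) :
    ∃ ψ : Formula n, (k ψ).Infinite ∧ k ψ ⊂ k φ := by
  by_contra hn
  refine hφ.2 ?_
  by_cases h₁ : cls φ ∈ J₁ n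
  · exact Or.inl h₁
  · refine Or.inr ⟨⟨hφ.1, h₁⟩, fun b hb hle => ?_⟩
    by_contra hlt
    obtain ⟨ψ, rfl⟩ := exists_cls_eq b
    exact hn ⟨ψ, fun hfin => hb.2 ((cls_mem_J₁_iff hb.1).2 hfin),
      cls_lt_cls_iff.1 (lt_of_le_not_ge hle hlt)⟩

/-! ## The lower part of an infinite irreducible set of nodes -/

theorem exists_forall_of_directed {n : ℕ} {D : Set (K n)} (hne : D.Nonempty)
    (hdir : ∀ α ∈ D, ∀ β ∈ D, ∃ γ ∈ D, γ ≤ α ∧ γ ≤ β) {ι : Type*} {s : Set ι} (hs : s.Finite)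
    {P : ι → K n → Prop} (hP : ∀ i ∈ s, ∀ β, ∀ γ ∈ D, γ ≤ β → P i β → P i γ)
    (h : ∀ i ∈ s, ∃ β ∈ D, P i β) : ∃ β ∈ D, ∀ i ∈ s, P i β := by
  induction s, hs using Set.Finite.induction_on with
  | empty =>
    obtain ⟨β, hβ⟩ := hne
    exact ⟨β, hβ, fun i hi => hi.elim⟩
  | @insert a s _ _ ih =>
    obtain ⟨α, hα, hα'⟩ := ih (fun i hi => hP i (Set.mem_insert_of_mem _ hi))
      fun i hi => h i (Set.mem_insert_of_mem _ hi)
    obtain ⟨β, hβ, hβ'⟩ := h a (Set.mem_insert _ _)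
    obtain ⟨γ, hγ, hγα, hγβ⟩ := hdir α hα β hβ
    refine ⟨γ, hγ, Set.forall_mem_insert.2 ⟨hP a (Set.mem_insert _ _) β γ hγ hγβ hβ', ?_⟩⟩
    exact fun i hi => hP i (Set.mem_insert_of_mem _ hi) α γ hγ hγα (hα' i hi)

/-- `D` is an upper set of nodes which, below its element `β₀`, is closed under forming nodes
with the variables of `β₀`. -/
structure ClosedBelow {n : ℕ} (D : Set (K n)) (β₀ : K n) : Prop where
  upper : IsUpperSet D
  mem : β₀ ∈ D
  w_subset : ∀ γ ∈ D, w β₀ ⊆ w γ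
  mem_of_isucc : ∀ γ ≤ β₀, w γ = w β₀ → isucc γ ⊆ D → γ ∈ D

/-- Directedness yields a `β₀` below which no subformula of `φ` and no variable becomes false within
`k φ`. A node below `β₀` with the same variables and with successors in `k φ` then agrees with `β₀`
on all subformulas, hence forces `φ`. -/
theorem exists_closedBelow {n : ℕ} {φ : Formula n} (hφ : cls φ ∈ J n) :
    ∃ β₀, ClosedBelow (k φ) β₀ := by
  obtain ⟨hne, hdir⟩ := cls_mem_J_iff.1 hφ
  obtain ⟨β₀, hβ₀, hst⟩ := exists_forall_of_directed hne hdir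
    ((finite_subformulas φ).union (Set.finite_range Formula.var))
    (P := fun χ β => ∀ γ ∈ k φ, γ ≤ β → Forces w β χ → Forces w γ χ)
    (fun χ _ β γ hγ hγβ h δ hδ hδγ hγχ => h δ hδ (hδγ.trans hγβ) (hγχ.mono hγβ)) (by
      intro χ _
      by_cases h : ∃ β ∈ k φ, ¬ Forces w β χ
      · obtain ⟨β, hβ, hβ'⟩ := h
        exact ⟨β, hβ, fun γ _ _ h => absurd h hβ'⟩
      · obtain ⟨β, hβ⟩ := hne
        refine ⟨β, hβ, fun γ hγ _ _ => ?_⟩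
        by_contra hn
        exact h ⟨γ, hγ, hn⟩)
  refine ⟨β₀, isUpperSet_k φ, hβ₀, fun γ hγ i hi => ?_, fun γ hγ hw hs => ?_⟩
  · obtain ⟨δ, hδ, hδβ, hδγ⟩ := hdir β₀ hβ₀ γ hγ
    exact w_mono hδγ (hst (.var i) (Or.inr ⟨i, rfl⟩) δ hδ hδβ hi)
  · have key : ∀ χ : Formula n, subformulas χ ⊆ subformulas φ →
        (Forces w γ χ ↔ Forces w β₀ χ) := by
      intro χ hχ
      induction χ with
      | var i => change i ∈ w γ ↔ i ∈ w β₀; rw [hw]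
      | bot => exact Iff.rfl
      | and φ₁ φ₂ ih₁ ih₂ =>
        exact and_congr (ih₁ fun _ h => hχ (Or.inr (Or.inl h)))
          (ih₂ fun _ h => hχ (Or.inr (Or.inr h)))
      | or φ₁ φ₂ ih₁ ih₂ =>
        exact or_congr (ih₁ fun _ h => hχ (Or.inr (Or.inl h)))
          (ih₂ fun _ h => hχ (Or.inr (Or.inr h)))
      | imp φ₁ φ₂ ih₁ ih₂ =>
        refine ⟨fun h => h.mono hγ, fun h δ hδ hδφ => ?_⟩
        rcases hδ.eq_or_lt with rfl | hlt
        · exact (ih₂ fun _ h => hχ (Or.inr (Or.inr h))).2 (h β₀ le_rfl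
            ((ih₁ fun _ h => hχ (Or.inr (Or.inl h))).1 hδφ))
        · obtain ⟨s, hsγ, hsδ⟩ := K.lt_iff.1 hlt
          -- The node `δ` need not be above `β₀`, so the implication is carried down to a common
          -- lower bound `β` and from there up to `δ`.
          obtain ⟨β, hβ, hββ₀, hβs⟩ := hdir β₀ hβ₀ s (hs hsγ)
          exact hst _ (Or.inl (hχ (Set.mem_insert _ _))) β hβ hββ₀ h δ (hβs.trans hsδ) hδφ
    exact (key φ subset_rfl).2 hβ₀

theorem ClosedBelow.exists_node {n : ℕ} {D : Set (K n)} {β₀ : K n} (hD : ClosedBelow D β₀)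
    {S : Set (K n)} (hS : S.Finite) (ha : IsAntichain (· ≤ ·) S) (hSD : S ⊆ D)
    (hnt : S.Nontrivial) {s : K n} (hs : s ∈ S) (hsβ : s ≤ β₀) :
    ∃ γ ∈ D, isucc γ = S ∧ γ ≤ β₀ := by
  obtain ⟨γ, hγw, hγ⟩ := FreeHeyting.exists_node hS ha (fun s hs => hD.w_subset s (hSD hs))
    fun s hs => absurd hs hnt.ne_singleton
  have hle : γ ≤ β₀ := (K.lt_of_mem_isucc (hγ ▸ hs)).le.trans hsβ
  exact ⟨γ, hD.mem_of_isucc γ hle hγw (hγ ▸ hSD), hγ, hle⟩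

theorem ClosedBelow.exists_node_pair {n : ℕ} {D : Set (K n)} {β₀ : K n}
    (hD : ClosedBelow D β₀) {α β : K n} (hα : α ∈ D) (hβ : β ∈ D) (hαβ : ¬ α ≤ β)
    (hβα : ¬ β ≤ α) (hle : α ≤ β₀) : ∃ γ ∈ D, isucc γ = {α, β} ∧ γ ≤ β₀ := by
  refine hD.exists_node (Set.toFinite _) ?_ (Set.pair_subset hα hβ)
    (Set.nontrivial_pair fun e => hαβ e.le) (Set.mem_insert _ _) hle
  rintro a (rfl | rfl) b (rfl | rfl) hab
  · exact absurd rfl hab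
  · exact hαβ
  · exact hβα
  · exact absurd rfl hab

theorem lt_iff_of_isucc_eq {n : ℕ} {γ δ : K n} {S : Set (K n)} (h : isucc γ = S) :
    γ < δ ↔ ∃ s ∈ S, s ≤ δ := h ▸ K.lt_iff

/-! ## The set generated below three incomparable nodes -/

/-- The nodes of `D` all of whose upper bounds are above one of the nodes `b i` or below at
least two of them. -/
def tripod {n : ℕ} (D : Set (K n)) (b : Fin 3 → K n) : Set (K n) :=
  {β ∈ D | ∀ δ, β ≤ δ → (∃ i, b i ≤ δ) ∨ ∃ i j, i ≠ j ∧ δ ≤ b i ∧ δ ≤ b j}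

theorem definable_tripod {n : ℕ} {D : Set (K n)} (hD : Definable D) (b : Fin 3 → K n) :
    Definable (tripod D b) := by
  have h : tripod D b = D ∩ {β | ∀ δ, β ≤ δ →
      δ ∈ (⋂ p ∈ {p : Fin 3 × Fin 3 | p.1 ≠ p.2}, ((Set.Iic (b p.1))ᶜ ∪ (Set.Iic (b p.2))ᶜ)) →
      δ ∈ ⋃ i ∈ (Set.univ : Set (Fin 3)), Set.Ici (b i)} := by
    ext β
    refine and_congr_right fun _ => forall₂_congr fun δ _ => ?_
    simp only [Set.mem_iInter, Set.mem_ofPred_eq, Set.mem_union, Set.mem_compl_iff, Set.mem_Iic,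
      Set.mem_iUnion, Set.mem_Ici, Set.mem_univ, exists_prop, true_and, Prod.forall]
    constructor
    · rintro (h | ⟨i, j, hij, hi, hj⟩) hall
      · exact h
      · exact ((hall i j hij).elim (absurd hi) (absurd hj))
    · intro h
      by_cases h' : ∃ i j, i ≠ j ∧ δ ≤ b i ∧ δ ≤ b j
      · exact Or.inr h'
      · refine Or.inl (h fun i j hij => ?_)
        by_contra hn
        rw [not_or, not_not, not_not] at hn
        exact h' ⟨i, j, hij, hn⟩
  rw [h]
  exact hD.inter ((Definable.biInter (Set.toFinite _) fun p _ =>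
    (definable_compl_Iic _).union (definable_compl_Iic _)).himp
    (.biUnion (Set.toFinite _) fun i _ => definable_Ici _))

/-- Three pairwise incomparable elements of `D` below `β₀`. -/
structure IsTriple {n : ℕ} (D : Set (K n)) (β₀ : K n) (b : Fin 3 → K n) : Prop where
  mem : ∀ i, b i ∈ D
  le : ∀ i, b i ≤ β₀
  eq_of_le : ∀ i j, b i ≤ b j → i = j

theorem IsTriple.exists_node {n : ℕ} {D : Set (K n)} {β₀ : K n} {b : Fin 3 → K n}
    (hb : IsTriple D β₀ b) (hD : ClosedBelow D β₀) {I : Set (Fin 3)} (hI : I.Nontrivial) :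
    ∃ γ ∈ D, γ ≤ β₀ ∧ ∀ δ, γ < δ ↔ ∃ i ∈ I, b i ≤ δ := by
  have hinj : Function.Injective b := fun i j h => hb.eq_of_le i j h.le
  obtain ⟨i, hi⟩ := hI.nonempty
  obtain ⟨γ, hγ, hs, hle⟩ := hD.exists_node (S := b '' I) (Set.toFinite _)
    (by
      rintro _ ⟨i, -, rfl⟩ _ ⟨j, -, rfl⟩ hij h
      exact hij (congrArg b (hb.eq_of_le i j h)))
    (by rintro _ ⟨i, -, rfl⟩; exact hb.mem i) (hI.image hinj)
    (Set.mem_image_of_mem b hi) (hb.le i)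
  exact ⟨γ, hγ, hle, fun δ => (lt_iff_of_isucc_eq hs).trans Set.exists_mem_image⟩

theorem IsTriple.mem_tripod {n : ℕ} {D : Set (K n)} {β₀ : K n} {b : Fin 3 → K n}
    (hb : IsTriple D β₀ b) (i : Fin 3) : b i ∈ tripod D b :=
  ⟨hb.mem i, fun _ h => Or.inl ⟨i, h⟩⟩

theorem IsTriple.exists_center {n : ℕ} {D : Set (K n)} {β₀ : K n} {b : Fin 3 → K n}
    (hb : IsTriple D β₀ b) (hD : ClosedBelow D β₀) :
    ∃ γ ∈ tripod D b, ∀ δ, γ < δ ↔ ∃ i, b i ≤ δ := by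
  obtain ⟨γ, hγ, -, h⟩ := hb.exists_node hD (I := Set.univ) Set.nontrivial_univ
  have h' : ∀ δ, γ < δ ↔ ∃ i, b i ≤ δ := fun δ => (h δ).trans (by simp)
  refine ⟨γ, ⟨hγ, fun δ hδ => ?_⟩, h'⟩
  rcases hδ.eq_or_lt with rfl | hlt
  · exact Or.inr ⟨0, 1, by decide, ((h' _).2 ⟨0, le_rfl⟩).le, ((h' _).2 ⟨1, le_rfl⟩).le⟩
  · exact Or.inl ((h' δ).1 hlt)

/-- A node with successors `α` and `β` stays in the tripod, because it inherits from `α` being below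
two of the `b i`. -/
theorem IsTriple.exists_le_le {n : ℕ} {D : Set (K n)} {β₀ : K n} {b : Fin 3 → K n}
    (hb : IsTriple D β₀ b) (hD : ClosedBelow D β₀) {α β : K n} (hα : α ∈ tripod D b)
    (hβ : β ∈ tripod D b) {i j : Fin 3} (hij : i ≠ j) (hi : α ≤ b i) (hj : α ≤ b j) :
    ∃ γ ∈ tripod D b, γ ≤ α ∧ γ ≤ β := by
  by_cases h₁ : α ≤ β
  · exact ⟨α, hα, le_rfl, h₁⟩
  by_cases h₂ : β ≤ α
  · exact ⟨β, hβ, h₂, le_rfl⟩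
  obtain ⟨γ, hγ, hs, -⟩ := hD.exists_node_pair hα.1 hβ.1 h₁ h₂ (hi.trans (hb.le i))
  have hγα : γ ≤ α := ((lt_iff_of_isucc_eq hs).2 ⟨α, Or.inl rfl, le_rfl⟩).le
  have hγβ : γ ≤ β := ((lt_iff_of_isucc_eq hs).2 ⟨β, Or.inr rfl, le_rfl⟩).le
  refine ⟨γ, ⟨hγ, fun δ hδ => ?_⟩, hγα, hγβ⟩
  rcases hδ.eq_or_lt with rfl | hlt
  · exact Or.inr ⟨i, j, hij, hγα.trans hi, hγα.trans hj⟩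
  · obtain ⟨s, rfl | rfl, hsδ⟩ := (lt_iff_of_isucc_eq hs).1 hlt
    · exact hα.2 δ hsδ
    · exact hβ.2 δ hsδ

theorem IsTriple.directed {n : ℕ} {D : Set (K n)} {β₀ : K n} {b : Fin 3 → K n}
    (hb : IsTriple D β₀ b) (hD : ClosedBelow D β₀) :
    ∀ α ∈ tripod D b, ∀ β ∈ tripod D b, ∃ γ ∈ tripod D b, γ ≤ α ∧ γ ≤ β := by
  intro α hα β hβ
  rcases hα.2 α le_rfl with ⟨i, hi⟩ | ⟨i, j, hij, hi, hj⟩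
  · rcases hβ.2 β le_rfl with ⟨j, hj⟩ | ⟨i, j, hij, hi, hj⟩
    · obtain ⟨γ, hγ, h⟩ := hb.exists_center hD
      exact ⟨γ, hγ, ((h α).2 ⟨i, hi⟩).le, ((h β).2 ⟨j, hj⟩).le⟩
    · obtain ⟨γ, hγ, h₁, h₂⟩ := hb.exists_le_le hD hβ hα hij hi hj
      exact ⟨γ, hγ, h₂, h₁⟩
  · exact hb.exists_le_le hD hα hβ hij hi hj

/-- The node `c i` has the two `b j` with `j ≠ i` as successors. Being below one `c i` is thus being
below two of the `b j`, which gives the inclusion; the node with all three `b i` as successors is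
lost. -/
theorem IsTriple.exists_ssubset {n : ℕ} {D : Set (K n)} {β₀ : K n} {b : Fin 3 → K n}
    (hb : IsTriple D β₀ b) (hD : ClosedBelow D β₀) :
    ∃ c, IsTriple D β₀ c ∧ tripod D c ⊂ tripod D b := by
  have hnt : ∀ i : Fin 3, ({i}ᶜ : Set (Fin 3)).Nontrivial := by
    have h : ∀ i : Fin 3, ∃ j l, j ≠ i ∧ l ≠ i ∧ j ≠ l := by decide
    intro i
    obtain ⟨j, l, hj, hl, hjl⟩ := h i
    exact ⟨j, hj, l, hl, hjl⟩
  choose c hcD hcβ hc using fun i => hb.exists_node hD (hnt i)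
  have hc_lt : ∀ i j, j ≠ i → c i < b j := fun i j h => (hc i _).2 ⟨j, h, le_rfl⟩
  have hc_not : ∀ i, ¬ c i ≤ b i := by
    intro i h
    rcases h.eq_or_lt with h | h
    · have h₁ : ∀ i : Fin 3, ∃ j, j ≠ i := by decide
      obtain ⟨j, hj⟩ := h₁ i
      exact hj (hb.eq_of_le i j (h ▸ (hc_lt i j hj).le)).symm
    · obtain ⟨j, hj, hji⟩ := (hc i _).1 h
      exact hj (hb.eq_of_le j i hji)
  have hct : IsTriple D β₀ c := by
    refine ⟨hcD, hcβ, fun i j h => ?_⟩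
    by_contra hij
    exact hc_not i (h.trans (hc_lt j i hij).le)
  refine ⟨c, hct, fun β hβ => ⟨hβ.1, fun δ hδ => ?_⟩, fun hsub => ?_⟩
  · have htwo : ∀ i, δ ≤ c i → ∃ i j, i ≠ j ∧ δ ≤ b i ∧ δ ≤ b j := by
      intro i h
      obtain ⟨j, hj, l, hl, hjl⟩ := hnt i
      exact ⟨j, l, hjl, h.trans (hc_lt i j hj).le, h.trans (hc_lt i l hl).le⟩
    rcases hβ.2 δ hδ with ⟨i, hi⟩ | ⟨i, -, -, hi, -⟩
    · rcases hi.eq_or_lt with h | h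
      · exact Or.inr (htwo i h.ge)
      · obtain ⟨j, -, hj⟩ := (hc i δ).1 h
        exact Or.inl ⟨j, hj⟩
    · exact Or.inr (htwo i hi)
  · obtain ⟨m, hm, hlt⟩ := hb.exists_center hD
    have hmb : ∀ i, m ≤ b i := fun i => ((hlt _).2 ⟨i, le_rfl⟩).le
    have hcm : ∀ i, ¬ c i ≤ m := fun i h => hc_not i (h.trans (hmb i))
    rcases (hsub hm).2 m le_rfl with ⟨i, hi⟩ | ⟨i, -, -, hi, -⟩
    · exact hcm i hi
    · rcases hi.eq_or_lt with h | h
      · exact hcm i h.ge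
      · obtain ⟨l, hl⟩ := (hlt _).1 h
        -- Here `b l ≤ c i`, and a third index `j` gives `c i < b j`, contradicting incomparability.
        have hex : ∀ i l : Fin 3, ∃ j, j ≠ i ∧ j ≠ l := by decide
        obtain ⟨j, hji, hjl⟩ := hex i l
        exact hjl (hb.eq_of_le l j (hl.trans (hc_lt i j hji).le)).symm

theorem IsTriple.infinite {n : ℕ} {D : Set (K n)} {β₀ : K n} {b : Fin 3 → K n}
    (hb : IsTriple D β₀ b) (hD : ClosedBelow D β₀) : (tripod D b).Infinite := by
  intro hfin
  induction hm : (tripod D b).ncard using Nat.strong_induction_on generalizing b with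
  | _ m ih =>
    obtain ⟨c, hc, hcb⟩ := hb.exists_ssubset hD
    exact ih _ (hm ▸ Set.ncard_lt_ncard hcb hfin) hc (hfin.subset hcb.subset) rfl

theorem IsTriple.cls_mem_J {n : ℕ} {D : Set (K n)} {β₀ : K n} {b : Fin 3 → K n}
    (hb : IsTriple D β₀ b) (hD : ClosedBelow D β₀) {ρ : Formula n} (hρ : k ρ = tripod D b) :
    cls ρ ∈ J n := by
  rw [cls_mem_J_iff, hρ]
  exact ⟨⟨b 0, hb.mem_tripod 0⟩, hb.directed hD⟩

theorem IsTriple.cls_mem_J₃ {n : ℕ} {D : Set (K n)} {β₀ : K n} {b : Fin 3 → K n}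
    (hb : IsTriple D β₀ b) (hD : ClosedBelow D β₀) (hdef : Definable D) {ρ : Formula n}
    (hρ : k ρ = tripod D b) : cls ρ ∈ J₃ n := by
  obtain ⟨c, hc, hcb⟩ := hb.exists_ssubset hD
  obtain ⟨σ, hσ⟩ := definable_tripod hdef c
  exact FreeHeyting.cls_mem_J₃ (hb.cls_mem_J hD hρ) (hc.cls_mem_J hD hσ)
    (hσ ▸ hc.infinite hD) (by rw [hσ, hρ]; exact hcb)

/-! ### Existence of a triple and choice of `ρ` -/

/-- If infinitely many elements of `D` are not below `α`, there are three incomparable nodes of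
`D` below `α`. -/
theorem ClosedBelow.exists_triple {n : ℕ} {D : Set (K n)} {β₀ : K n} (hD : ClosedBelow D β₀)
    {α : K n} (hα : α ∈ D) (hαβ : α ≤ β₀) (hinf : (D \ Set.Iic α).Infinite) :
    ∃ b, IsTriple D β₀ b ∧ ∀ i, b i ≤ α := by
  -- These three nodes are incomparable with `α`, though perhaps not with each other. Pairing each
  -- with `α` as successors makes the resulting nodes incomparable.
  obtain ⟨p, hp⟩ := (hinf.sdiff (finite_Ici α)).exists_subset_ncard_eq 3
  have e : Nonempty (Fin 3 ≃ p) := by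
    have := Nat.finite_of_card_ne_zero (α := p) (by
      rw [Nat.card_coe_set_eq, hp.2.2]; decide)
    exact ⟨(Finite.equivFinOfCardEq (by rw [Nat.card_coe_set_eq, hp.2.2])).symm⟩
  obtain ⟨e⟩ := e
  have hex : ∀ i, ∃ γ ∈ D, isucc γ = {α, (e i).1} ∧ γ ≤ β₀ := fun i =>
    hD.exists_node_pair hα (hp.1 (e i).2).1.1 (hp.1 (e i).2).2 (hp.1 (e i).2).1.2 hαβ
  choose b hbD hbs hbβ using hex
  have hbα : ∀ i, b i < α := fun i => (lt_iff_of_isucc_eq (hbs i)).2 ⟨α, Or.inl rfl, le_rfl⟩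
  refine ⟨b, ⟨hbD, hbβ, fun i j h => ?_⟩, fun i => (hbα i).le⟩
  rcases h.eq_or_lt with h | h
  · have hmem : (e i).1 ∈ isucc (b j) := h ▸ hbs i ▸ Or.inr rfl
    rcases (hbs j).subset hmem with h' | h'
    · exact absurd h'.le (hp.1 (e i).2).1.2
    · exact e.injective (Subtype.ext h')
  · obtain ⟨s, rfl | rfl, hs⟩ := (lt_iff_of_isucc_eq (hbs i)).1 h
    · exact absurd hs (hbα j).not_ge
    · exact absurd (hs.trans (hbα j).le) (hp.1 (e i).2).1.2

theorem tripod_inter_finite {n : ℕ} {D : Set (K n)} {b : Fin 3 → K n} {α : K n}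
    (hb : ∀ i, b i ≤ α) {ψ : Formula n} (hα : α ∉ k ψ) : (tripod D b ∩ k ψ).Finite := by
  refine (Set.finite_iUnion fun i => finite_Ici (b i)).subset fun δ hδ => ?_
  rcases hδ.1.2 δ le_rfl with h | ⟨i, -, -, hi, -⟩
  · exact Set.mem_iUnion.2 h
  · exact absurd (hδ.2.mono (hi.trans (hb i))) hα

theorem exists_mem_J₃_lt {n : ℕ} {φ : Formula n} (hφ : cls φ ∈ J₃ n) {S : Set (Formula n)}
    (hfin : S.Finite) (hS : ∀ ψ ∈ S, ¬ cls φ ≤ cls ψ) :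
    ∃ ρ : Formula n, cls ρ ∈ J₃ n ∧ cls ρ < cls φ ∧ ∀ ψ ∈ S, (k ρ ∩ k ψ).Finite := by
  obtain ⟨χ, hχinf, hχ⟩ := exists_infinite_ssubset_of_mem_J₃ hφ
  obtain ⟨hne, hdir⟩ := cls_mem_J_iff.1 hφ.1
  obtain ⟨β₀, hD⟩ := exists_closedBelow hφ.1
  -- Avoiding `χ` too serves twice: the infinite set `k χ` then misses the lower set of `α`, and it
  -- meets `k ρ` in a finite set, so `ρ` is strictly below `φ`.
  obtain ⟨α₁, hα₁, hα₁S⟩ := exists_forall_of_directed hne hdir (hfin.insert χ)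
    (P := fun ψ β => β ∉ k ψ) (fun ψ _ β γ _ hγβ hβ hγ => hβ (isUpperSet_k ψ hγβ hγ))
    (Set.forall_mem_insert.2 ⟨Set.exists_of_ssubset hχ, fun ψ hψ => by
      have h := hS ψ hψ
      rw [cls_le_cls_iff] at h
      exact Set.not_subset.1 h⟩)
  obtain ⟨α, hα, hαβ, hαα₁⟩ := hdir β₀ hD.mem α₁ hα₁
  have hαS : ∀ ψ ∈ insert χ S, α ∉ k ψ := fun ψ hψ h =>
    hα₁S ψ hψ (isUpperSet_k ψ hαα₁ h)
  have hinf : (k φ \ Set.Iic α).Infinite := hχinf.mono fun γ hγ =>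
    ⟨hχ.subset hγ, fun h => hαS χ (Set.mem_insert _ _) (isUpperSet_k χ h hγ)⟩
  obtain ⟨b, hb, hbα⟩ := hD.exists_triple hα hαβ hinf
  obtain ⟨ρ, hρ⟩ := definable_tripod ⟨φ, rfl⟩ b
  have hsub : k ρ ⊆ k φ := hρ ▸ fun β hβ => hβ.1
  refine ⟨ρ, hb.cls_mem_J₃ hD ⟨φ, rfl⟩ hρ, cls_lt_cls_iff.2 ⟨hsub, fun h => ?_⟩,
    fun ψ hψ => hρ ▸ tripod_inter_finite hbα (hαS ψ (Set.mem_insert_of_mem _ hψ))⟩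
  refine hχinf ((tripod_inter_finite (D := k φ) hbα (hαS χ (Set.mem_insert _ _))).subset fun γ hγ => ?_)
  exact ⟨hρ ▸ h (hχ.subset hγ), hγ⟩

end FreeHeyting

theorem mainTheorem7 (n : ℕ) (φ : FreeHeyting.Formula n)
    (hφ : FreeHeyting.cls φ ∈ FreeHeyting.J₃ n)
    (S : Set (FreeHeyting.Formula n)) (hfin : S.Finite)
    (hirr : ∀ ψ ∈ S, FreeHeyting.cls ψ ∈ FreeHeyting.J n)
    (hS : ∀ ψ ∈ S, ¬ FreeHeyting.cls φ ≤ FreeHeyting.cls ψ) :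
    ∃ ρ : FreeHeyting.Formula n,
      FreeHeyting.cls ρ ∈ FreeHeyting.J₃ n ∧
      FreeHeyting.cls ρ < FreeHeyting.cls φ ∧
      ∀ ψ ∈ S, (FreeHeyting.k ρ ∩ FreeHeyting.k ψ).Finite :=
  FreeHeyting.exists_mem_J₃_lt hφ hfin hS
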